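/- Identify subsets of $\omega$ with their characteristic functions in $2^{\omega}$, so that a filter on $\omega$ becomes a subset of $2^{\omega}$. Let $(p_n)_{n\in\omega}$ be a sequence of reals with $p_n\in(0,\tfrac12]$ for all $n$, and let $\mu_{\hat p}$ be the product measure on $2^{\omega}$ with $\mu_{\hat p}(\{x: x(n)=1\})=p_n$ and $\mu_{\hat p}(\{x: x(n)=0\})=1-p_n$ for all $n$ (if all $p_n=\tfrac12$, this is the usual Lebesgue measure on $2^\omega$). Let $\mathcal F$ be a proper nonprincipal filter on $\omega$ (that is, $\emptyset\notin\mathcal F$ and there is no $A\subseteq\omega$ with $\mathcal F=\{X\subseteq\omega: A\subseteq X\}$) which is a Borel, or more generally an analytic, subset of $2^{\omega}$. Then there is a set $K\subseteq 2^{\omega}$ of type $F_\sigma$ such that $\mu_{\hat p}(K)=0$ and $\mathcal F\subseteq K$. -/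

import Mathlib

open MeasureTheory ProbabilityTheory

/-- The family of (characteristic functions of) elements of a filter `F` on `ω`, as a subset of
the Cantor space `2^ω`. -/
def filterSet (F : Filter ℕ) : Set (ℕ → Bool) :=
  {x | {n | x n = true} ∈ F}

/-- The product measure on `2^ω` giving mass `p n` to `{x | x n = 1}` and mass `1 - p n` to
`{x | x n = 0}`. When `p n = 1/2` for all `n` it is the Lebesgue (coin-tossing) measure. -/
noncomputable def cantorMeasure (p : ℕ → unitInterval) : Measure (ℕ → Bool) :=
  Measure.infinitePi fun n => bernoulliMeasure true false (p n)

/-- A set of type `F_σ`: a countable union of closed sets. -/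
def IsFSigma {X : Type*} [TopologicalSpace X] (s : Set X) : Prop :=
  ∃ C : ℕ → Set X, (∀ n, IsClosed (C n)) ∧ s = ⋃ n, C n

/-!
A set belongs to the σ-ideal generated by the closed null sets exactly when it is covered by a null
`F_σ` set. Suppose an analytic set `S = range f`, with `f` a continuous function on Baire space,
does not belong to it. Removing from Baire space all open sets whose image belongs to the ideal
leaves a nonempty kernel `P` such that every nonempty relatively open part of `P` has an image with
closure of positive measure.

We build three points of `S` whose supports have finite intersection. Each point is approximated by
a cylinder of Baire space together with a cylinder of Cantor space, the latter having a part of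
positive proportion in the closure of the image of the former. By turns, one point moves: it
extends its argument and passes to a cylinder that its new closed set fills almost completely (a
Lebesgue density argument). Meanwhile the other two must be prolonged to the same length, and they
are prolonged with disjoint supports: as `p n ≤ 1 / 2`, two biased coins can be coupled so that they
never show `1` together, so the sum of the two proportions need not decrease. As long as that sum
exceeds `1`, both proportions stay positive. Two points do not suffice, because the moving point
is not controlled.

A filter containing a finite set is principal, so this is impossible for `S = filterSet F`.
-/

open PiNat Set Function Topology

section CylinderDensity

variable {E : ℕ → Type*}

theorem cylinder_subset_cylinder_of_mem {x y : ∀ n, E n} {m n : ℕ} (h : m ≤ n)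
    (hy : y ∈ cylinder x m) : cylinder y n ⊆ cylinder x m :=
  mem_cylinder_iff_eq.1 hy ▸ cylinder_anti y h

theorem pairwiseDisjoint_range_cylinder (n : ℕ) :
    (range fun x : ∀ n, E n => cylinder x n).PairwiseDisjoint id := by
  rintro _ ⟨x, rfl⟩ _ ⟨y, rfl⟩ hne
  refine Set.disjoint_left.2 fun z hzx hzy => hne ?_
  exact (mem_cylinder_iff_eq.1 hzx).symm.trans (mem_cylinder_iff_eq.1 hzy)

theorem disjoint_cylinder_update (x : ∀ n, E n) (n : ℕ) {a b : E n} (hab : a ≠ b) :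
    Disjoint (cylinder (update x n a) (n + 1)) (cylinder (update x n b) (n + 1)) := by
  refine Set.disjoint_left.2 fun y ha hb => hab ?_
  have hya := ha n n.lt_succ_self
  have hyb := hb n n.lt_succ_self
  rw [update_self] at hya hyb
  exact hya.symm.trans hyb

variable [∀ n, TopologicalSpace (E n)] [∀ n, DiscreteTopology (E n)]

theorem isClosed_cylinder (x : ∀ n, E n) (n : ℕ) : IsClosed (cylinder x n) := by
  rw [cylinder_eq_pi]
  exact isClosed_set_pi fun _ _ => isClosed_discrete _

theorem exists_cylinder_subset_of_isOpen {U : Set (∀ n, E n)} (hU : IsOpen U) {x : ∀ n, E n}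
    (hx : x ∈ U) : ∃ n, cylinder x n ⊆ U := by
  obtain ⟨n, hn⟩ := exists_disjoint_cylinder hU.isClosed_compl (not_not_intro hx)
  exact ⟨n, disjoint_compl_left_iff_subset.1 hn⟩

theorem iInter_biUnion_cylinder_of_isClosed {C : Set (∀ n, E n)} (hC : IsClosed C) :
    ⋂ n, ⋃ z ∈ C, cylinder z n = C := by
  refine Subset.antisymm (fun y hy => ?_) fun y hy =>
    mem_iInter.2 fun n => mem_biUnion hy (self_mem_cylinder _ _)
  by_contra hyC
  obtain ⟨n, hn⟩ := exists_disjoint_cylinder hC hyC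
  obtain ⟨z, hzC, hyz⟩ := mem_iUnion₂.1 (mem_iInter.1 hy n)
  exact Set.disjoint_left.1 hn hzC ((mem_cylinder_comm _ _ _).1 hyz)

variable [∀ n, Countable (E n)] [MeasurableSpace (∀ n, E n)] [OpensMeasurableSpace (∀ n, E n)]

theorem measure_le_mul_measure_biUnion_cylinder {μ : Measure (∀ n, E n)} {C : Set (∀ n, E n)}
    {r : ENNReal} {n : ℕ} (h : ∀ z ∈ C, μ (cylinder z n ∩ C) ≤ r * μ (cylinder z n)) :
    μ C ≤ r * μ (⋃ z ∈ C, cylinder z n) := by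
  let 𝒮 : Set (Set (∀ n, E n)) := (fun z => cylinder z n) '' C
  have hdisj : 𝒮.PairwiseDisjoint id :=
    (pairwiseDisjoint_range_cylinder n).subset (image_subset_range _ _)
  have hopen : ∀ S ∈ 𝒮, IsOpen S := by
    rintro _ ⟨z, -, rfl⟩
    exact isOpen_cylinder E z n
  have hcount : 𝒮.Countable := hdisj.countable_of_isOpen hopen <| by
    rintro _ ⟨z, -, rfl⟩
    exact ⟨z, self_mem_cylinder z n⟩
  have hcover : C ⊆ ⋃ S ∈ 𝒮, S ∩ C := fun z hz =>
    mem_biUnion (mem_image_of_mem _ hz) ⟨self_mem_cylinder z n, hz⟩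
  calc μ C ≤ ∑' S : 𝒮, μ (S ∩ C) := (measure_mono hcover).trans (measure_biUnion_le μ hcount _)
    _ ≤ ∑' S : 𝒮, r * μ S := by
        refine ENNReal.tsum_le_tsum ?_
        rintro ⟨_, z, hz, rfl⟩
        exact h z hz
    _ = r * μ (⋃₀ 𝒮) := by
        rw [ENNReal.tsum_mul_left,
          measure_sUnion hcount hdisj fun S hS => (hopen S hS).measurableSet]
    _ = r * μ (⋃ z ∈ C, cylinder z n) := by rw [sUnion_image]

theorem exists_lt_cond_cylinder_of_isClosed {μ : Measure (∀ n, E n)} [IsFiniteMeasure μ]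
    {C : Set (∀ n, E n)} (hC : IsClosed C) (hμC : μ C ≠ 0) {r : ENNReal} (hr : r < 1) (N : ℕ) :
    ∃ z ∈ C, ∃ n, N ≤ n ∧ r < μ[C | cylinder z n] := by
  by_contra! h
  let U : ℕ → Set (∀ n, E n) := fun n => ⋃ z ∈ C, cylinder z n
  have hU : ∀ n, MeasurableSet (U n) := fun n =>
    (isOpen_biUnion fun z _ => isOpen_cylinder E z n).measurableSet
  have hanti : Antitone U := fun m n hmn => biUnion_mono Subset.rfl fun z _ => cylinder_anti z hmn
  have hlim : Filter.Tendsto (fun n => r * μ (U n)) Filter.atTop (𝓝 (r * μ C)) := by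
    have := tendsto_measure_iInter_atTop (fun n => (hU n).nullMeasurableSet) hanti
      ⟨0, measure_ne_top μ _⟩
    rw [iInter_biUnion_cylinder_of_isClosed hC] at this
    exact ENNReal.Tendsto.const_mul this (.inr hr.ne_top)
  have hbound : ∀ n, N ≤ n → μ C ≤ r * μ (U n) := fun n hn =>
    measure_le_mul_measure_biUnion_cylinder fun z hz => by
      rw [← cond_mul_eq_inter (isOpen_cylinder E z n).measurableSet]
      gcongr
      exact h z hz n hn
  have hle : μ C ≤ r * μ C := ge_of_tendsto hlim (Filter.eventually_atTop.2 ⟨N, hbound⟩)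
  have hlt : r * μ C < 1 * μ C := ENNReal.mul_lt_mul_left hμC (measure_ne_top μ C) hr
  exact (hle.trans_lt hlt).ne (one_mul _).symm

end CylinderDensity

section InfinitePi

variable {X : ℕ → Type*} [∀ n, MeasurableSpace (X n)] [∀ n, MeasurableSingletonClass (X n)]

theorem measurableSet_cylinder (x : ∀ n, X n) (n : ℕ) : MeasurableSet (cylinder x n) := by
  rw [cylinder_eq_pi]
  exact .pi (Finset.countable_toSet _) fun _ _ => measurableSet_singleton _

variable (μ : ∀ n, Measure (X n)) [∀ n, IsProbabilityMeasure (μ n)]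

theorem infinitePi_real_cylinder (x : ∀ n, X n) (n : ℕ) :
    (Measure.infinitePi μ).real (cylinder x n) = ∏ i ∈ Finset.range n, (μ i).real {x i} := by
  rw [cylinder_eq_pi, measureReal_def,
    Measure.infinitePi_pi _ fun _ _ => measurableSet_singleton _, ENNReal.toReal_prod]
  rfl

theorem infinitePi_real_cylinder_update (x : ∀ n, X n) (n : ℕ) (a : X n) :
    (Measure.infinitePi μ).real (cylinder (update x n a) (n + 1)) =
      (Measure.infinitePi μ).real (cylinder x n) * (μ n).real {a} := by
  rw [infinitePi_real_cylinder, infinitePi_real_cylinder, Finset.prod_range_succ, update_self]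
  congr 1
  refine Finset.prod_congr rfl fun i hi => ?_
  rw [update_of_ne (Finset.mem_range.1 hi).ne]

theorem infinitePi_cond_cylinder_eq_sum (x : ∀ n, X n) (n : ℕ) [Fintype (X n)]
    (E : Set (∀ n, X n)) :
    (Measure.infinitePi μ)[|cylinder x n].real E =
      ∑ a, (μ n).real {a} * (Measure.infinitePi μ)[|cylinder (update x n a) (n + 1)].real E := by
  set ν := Measure.infinitePi μ with hν
  have hsplit : ν.real (cylinder x n ∩ E) =
      ∑ a, ν.real (cylinder (update x n a) (n + 1) ∩ E) := by
    simp only [← measureReal_restrict_apply (measurableSet_cylinder _ _)]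
    rw [← iUnion_cylinder_update x n]
    exact measureReal_iUnion_fintype (fun _ _ hab => disjoint_cylinder_update x n hab)
      fun _ => measurableSet_cylinder _ _
  simp only [measureReal_def, cond_apply (measurableSet_cylinder _ _), ENNReal.toReal_mul,
    ENNReal.toReal_inv]
  simp only [← measureReal_def, hsplit, Finset.mul_sum]
  refine Finset.sum_congr rfl fun a _ => ?_
  have hcyl := infinitePi_real_cylinder_update μ x n a
  rw [← hν] at hcyl
  rcases eq_or_ne ((μ n).real {a}) 0 with ha | ha
  · have hnull : ν.real (cylinder (update x n a) (n + 1) ∩ E) = 0 :=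
      measureReal_mono_null inter_subset_left (by rw [hcyl, ha, mul_zero])
    rw [hnull, ha, mul_zero, zero_mul]
  · rw [hcyl]
    field_simp

end InfinitePi

section Coupling

variable {p : ℕ → unitInterval}

instance (p : ℕ → unitInterval) : IsProbabilityMeasure (cantorMeasure p) :=
  inferInstanceAs (IsProbabilityMeasure (Measure.infinitePi _))

theorem cantorMeasure_cond_cylinder_eq (E : Set (ℕ → Bool)) (x : ℕ → Bool) (n : ℕ) :
    (cantorMeasure p)[|cylinder x n].real E =
      p n * (cantorMeasure p)[|cylinder (update x n true) (n + 1)].real E +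
      (1 - p n) * (cantorMeasure p)[|cylinder (update x n false) (n + 1)].real E := by
  rw [cantorMeasure, infinitePi_cond_cylinder_eq_sum, Fintype.sum_bool]
  simp

theorem exists_update_disjoint_le_cond_add_cond {n : ℕ} (hp : (p n : ℝ) ≤ 1 / 2)
    (E E' : Set (ℕ → Bool)) (x y : ℕ → Bool) :
    ∃ b c : Bool, (b = false ∨ c = false) ∧
      (cantorMeasure p)[|cylinder x n].real E + (cantorMeasure p)[|cylinder y n].real E' ≤
        (cantorMeasure p)[|cylinder (update x n b) (n + 1)].real E +
          (cantorMeasure p)[|cylinder (update y n c) (n + 1)].real E' := by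
  rw [cantorMeasure_cond_cylinder_eq E, cantorMeasure_cond_cylinder_eq E']
  -- Average over the coupling that gives `(1, 0)`, `(0, 1)`, `(0, 0)` the weights `p n`, `p n`,
  -- `1 - 2 * p n`.
  by_contra! h
  have h10 := h true false (by decide)
  have h01 := h false true (by decide)
  have h00 := h false false (by decide)
  rcases (p n).2.1.eq_or_lt with h0 | h0
  · rw [← h0] at h00
    linarith
  · have hw10 := mul_lt_mul_of_pos_left h10 h0
    have hw01 := mul_lt_mul_of_pos_left h01 h0
    have hw00 := mul_le_mul_of_nonneg_left h00.le (by linarith : 0 ≤ 1 - 2 * (p n : ℝ))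
    linarith

theorem exists_disjoint_extension_le_cond_add_cond (hp : ∀ n, (p n : ℝ) ≤ 1 / 2)
    (E E' : Set (ℕ → Bool)) (x y : ℕ → Bool) {n m : ℕ} (hnm : n ≤ m) :
    ∃ x' ∈ cylinder x n, ∃ y' ∈ cylinder y n,
      (∀ i, n ≤ i → i < m → x' i = false ∨ y' i = false) ∧
      (cantorMeasure p)[|cylinder x n].real E + (cantorMeasure p)[|cylinder y n].real E' ≤
        (cantorMeasure p)[|cylinder x' m].real E + (cantorMeasure p)[|cylinder y' m].real E' := by
  induction m, hnm using Nat.le_induction with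
  | base =>
    exact ⟨x, self_mem_cylinder _ _, y, self_mem_cylinder _ _, fun i h h' => by omega, le_rfl⟩
  | succ m hnm ih =>
    obtain ⟨x', hx', y', hy', hdisj, hle⟩ := ih
    obtain ⟨b, c, hbc, hle'⟩ := exists_update_disjoint_le_cond_add_cond (hp m) E E' x' y'
    refine ⟨update x' m b, fun i hi => ?_, update y' m c, fun i hi => ?_, fun i hi hi' => ?_,
      hle.trans hle'⟩
    · rw [update_of_ne (by omega), hx' i hi]
    · rw [update_of_ne (by omega), hy' i hi]
    · rcases Nat.lt_succ_iff_lt_or_eq.1 hi' with him | rfl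
      · rw [update_of_ne him.ne, update_of_ne him.ne]
        exact hdisj i hi him
      · simpa only [update_self] using hbc

end Coupling

section ClosedNullIdeal

theorem isFSigma_iff_isGδ_compl {X : Type*} [TopologicalSpace X] {s : Set X} :
    IsFSigma s ↔ IsGδ sᶜ := by
  rw [isGδ_iff_eq_iInter_nat]
  constructor
  · rintro ⟨C, hC, rfl⟩
    exact ⟨fun n => (C n)ᶜ, fun n => (hC n).isOpen_compl, compl_iUnion C⟩
  · rintro ⟨U, hU, hsU⟩
    exact ⟨fun n => (U n)ᶜ, fun n => (hU n).isClosed_compl, by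
      rw [← compl_iInter, ← hsU, compl_compl]⟩

theorem isFSigma_of_isClosed {X : Type*} [TopologicalSpace X] {s : Set X} (hs : IsClosed s) :
    IsFSigma s :=
  ⟨fun _ => s, fun _ => hs, (iUnion_const s).symm⟩

theorem isFSigma_iUnion {X ι : Type*} [TopologicalSpace X] [Countable ι] {s : ι → Set X}
    (hs : ∀ i, IsFSigma (s i)) : IsFSigma (⋃ i, s i) := by
  rw [isFSigma_iff_isGδ_compl, compl_iUnion]
  exact IsGδ.iInter fun i => isFSigma_iff_isGδ_compl.1 (hs i)

/-- Membership in the σ-ideal generated by the closed null sets of `μ`. -/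
def CoveredByNullFSigma {X : Type*} [TopologicalSpace X] [MeasurableSpace X] (μ : Measure X)
    (s : Set X) : Prop :=
  ∃ K, IsFSigma K ∧ μ K = 0 ∧ s ⊆ K

namespace CoveredByNullFSigma

variable {X : Type*} [TopologicalSpace X] [MeasurableSpace X] {μ : Measure X} {s t : Set X}

theorem mono (ht : CoveredByNullFSigma μ t) (hst : s ⊆ t) : CoveredByNullFSigma μ s :=
  let ⟨K, hK, hμK, htK⟩ := ht
  ⟨K, hK, hμK, hst.trans htK⟩

theorem of_measure_closure_eq_zero (hs : μ (closure s) = 0) : CoveredByNullFSigma μ s :=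
  ⟨closure s, isFSigma_of_isClosed isClosed_closure, hs, subset_closure⟩

theorem iUnion {ι : Type*} [Countable ι] {s : ι → Set X}
    (hs : ∀ i, CoveredByNullFSigma μ (s i)) : CoveredByNullFSigma μ (⋃ i, s i) := by
  choose K hK hμK hsK using hs
  exact ⟨⋃ i, K i, isFSigma_iUnion hK, measure_iUnion_null hμK, iUnion_mono hsK⟩

theorem union (hs : CoveredByNullFSigma μ s) (ht : CoveredByNullFSigma μ t) :
    CoveredByNullFSigma μ (s ∪ t) := by
  rw [union_eq_iUnion]
  exact iUnion (Bool.forall_bool.2 ⟨ht, hs⟩)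

end CoveredByNullFSigma

/-- Every nonempty relatively open part of `P` has an image under `f` whose closure is not null.
This makes `f '' P` large everywhere with respect to the σ-ideal generated by closed null sets. -/
def HasNonnullHulls {Z X : Type*} [TopologicalSpace Z] [TopologicalSpace X] [MeasurableSpace X]
    (μ : Measure X) (f : Z → X) (P : Set Z) : Prop :=
  ∀ V, IsOpen V → (P ∩ V).Nonempty → μ (closure (f '' (P ∩ V))) ≠ 0

theorem coveredByNullFSigma_range_or_exists_hasNonnullHulls {Z X : Type*} [TopologicalSpace Z]
    [SecondCountableTopology Z] [TopologicalSpace X] [MeasurableSpace X] (μ : Measure X)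
    (f : Z → X) :
    CoveredByNullFSigma μ (range f) ∨ ∃ P : Set Z, P.Nonempty ∧ HasNonnullHulls μ f P := by
  let 𝒱 : Set (Set Z) := {V | IsOpen V ∧ CoveredByNullFSigma μ (f '' V)}
  have hcovered : CoveredByNullFSigma μ (f '' ⋃₀ 𝒱) := by
    obtain ⟨T, hT, hT𝒱, hTU⟩ := TopologicalSpace.isOpen_sUnion_countable 𝒱 fun V hV => hV.1
    have := hT.to_subtype
    rw [← hTU, sUnion_eq_iUnion, image_iUnion]
    exact .iUnion fun V => (hT𝒱 V.2).2
  rcases (⋃₀ 𝒱)ᶜ.eq_empty_or_nonempty with hempty | hne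
  · rw [compl_empty_iff.1 hempty, image_univ] at hcovered
    exact .inl hcovered
  refine .inr ⟨(⋃₀ 𝒱)ᶜ, hne, fun V hV ⟨a, haU, haV⟩ hnull => haU ⟨V, ⟨hV, ?_⟩, haV⟩⟩
  refine (hcovered.union (.of_measure_closure_eq_zero hnull)).mono ?_
  rw [← image_union]
  exact image_mono fun b hb => (em (b ∈ ⋃₀ 𝒱)).imp_right fun hbU => ⟨hbU, hb⟩

end ClosedNullIdeal

theorem forall_fin_three_iff_add {q : Fin 3 → Prop} (i : Fin 3) :
    (∀ j, q j) ↔ q i ∧ q (i + 1) ∧ q (i + 2) := by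
  rw [← (Equiv.addLeft i).forall_congr_right]
  simp [Fin.forall_fin_succ]

/-- A basic open box of `ω^ω × 2^ω`, the product of the cylinders of length `depth` around `arg` and
of length `length` around `value`. It approximates a point of the graph of a map `ω^ω → 2^ω`. -/
structure GraphBox where
  arg : ℕ → ℕ
  depth : ℕ
  value : ℕ → Bool
  length : ℕ

namespace GraphBox

/-- The box `B` lies inside the box `A`, with cylinders at least as long: it approximates the same
point at least as well. -/
structure Refines (B A : GraphBox) : Prop where
  depth_le : A.depth ≤ B.depth
  arg_mem : B.arg ∈ cylinder A.arg A.depth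
  length_le : A.length ≤ B.length
  value_mem : B.value ∈ cylinder A.value A.length

/-- Boxes are ordered by refinement, larger meaning more information. -/
instance : Preorder GraphBox where
  le A B := B.Refines A
  le_refl _ := ⟨le_rfl, self_mem_cylinder _ _, le_rfl, self_mem_cylinder _ _⟩
  le_trans _ _ _ h h' :=
    ⟨h.depth_le.trans h'.depth_le, cylinder_subset_cylinder_of_mem h.depth_le h.arg_mem h'.arg_mem,
      h.length_le.trans h'.length_le,
      cylinder_subset_cylinder_of_mem h.length_le h.value_mem h'.value_mem⟩

/-- The box `B` properly refines `A`, and the values of `f` on its arguments agree with `A`. -/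
structure Decides (f : (ℕ → ℕ) → ℕ → Bool) (A B : GraphBox) : Prop where
  le : A ≤ B
  depth_lt : A.depth < B.depth
  length_lt : A.length < B.length
  mapsTo : MapsTo f (cylinder B.arg B.depth) (cylinder A.value A.length)

variable {f : (ℕ → ℕ) → ℕ → Bool} {A B D : GraphBox}

theorem Decides.trans_le (h : Decides f A B) (h' : B ≤ D) : Decides f A D where
  le := h.le.trans h'
  depth_lt := h.depth_lt.trans_le h'.depth_le
  length_lt := h.length_lt.trans_le h'.length_le
  mapsTo := h.mapsTo.mono_left (cylinder_subset_cylinder_of_mem h'.depth_le h'.arg_mem)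

theorem Decides.of_le (h' : Decides f B D) (h : A ≤ B) : Decides f A D where
  le := h.trans h'.le
  depth_lt := h.depth_le.trans_lt h'.depth_lt
  length_lt := h.length_le.trans_lt h'.length_lt
  mapsTo := h'.mapsTo.mono_right (cylinder_subset_cylinder_of_mem h.length_le h.value_mem)

theorem exists_mem_range_of_decides {A : ℕ → GraphBox} (h : ∀ k, Decides f (A k) (A (k + 1))) :
    ∃ x ∈ range f, ∀ k, x ∈ cylinder (A k).value (A k).length := by
  have hmono : Monotone A := monotone_nat_of_le_succ fun k => (h k).le
  have hdepth : StrictMono fun k => (A k).depth := strictMono_nat_of_lt_succ fun k => (h k).depth_lt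
  let a : ℕ → ℕ := fun i => (A (i + 1)).arg i
  have ha : ∀ k, a ∈ cylinder (A k).arg (A k).depth := by
    intro k i hi
    rcases le_total k (i + 1) with hk | hk
    · exact (hmono hk).arg_mem i hi
    · have hi' : i < (A (i + 1)).depth := i.lt_succ_self.trans_le (hdepth.le_apply (x := i + 1))
      exact ((hmono hk).arg_mem i hi').symm
  exact ⟨f a, mem_range_self a, fun k => (h k).mapsTo (ha (k + 1))⟩

/-- The closed set to which the values on the part of `P` inside the box are confined. -/
def hull (f : (ℕ → ℕ) → ℕ → Bool) (P : Set (ℕ → ℕ)) (A : GraphBox) : Set (ℕ → Bool) :=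
  closure (f '' (P ∩ cylinder A.arg A.depth))

/-- The proportion of the value cylinder of a box that is occupied by the hull of the box. -/
noncomputable def filling (μ : Measure (ℕ → Bool)) (f : (ℕ → ℕ) → ℕ → Bool) (P : Set (ℕ → ℕ))
    (A : GraphBox) : ℝ :=
  μ[|cylinder A.value A.length].real (A.hull f P)

variable {μ : Measure (ℕ → Bool)} {P : Set (ℕ → ℕ)}

theorem filling_le_one : A.filling μ f P ≤ 1 :=
  measureReal_le_one

theorem nonempty_inter_preimage_of_filling_pos (hA : 0 < A.filling μ f P) :
    (P ∩ (cylinder A.arg A.depth ∩ f ⁻¹' cylinder A.value A.length)).Nonempty := by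
  have hne : (cylinder A.value A.length ∩ A.hull f P).Nonempty := by
    by_contra! hempty
    simp [filling, measureReal_def, cond_apply (measurableSet_cylinder _ _), hempty] at hA
  obtain ⟨y, hy, hyA⟩ := hne
  obtain ⟨_, hw, a, ⟨haP, ha⟩, rfl⟩ := mem_closure_iff.1 hyA _ (isOpen_cylinder _ _ _) hy
  exact ⟨a, haP, ha, hw⟩

theorem exists_decides_lt_filling [IsFiniteMeasure μ] (hf : Continuous f)
    (hP : HasNonnullHulls μ f P) (hA : 0 < A.filling μ f P) {r : ℝ} (hr : r < 1) :
    ∃ B, Decides f A B ∧ r < B.filling μ f P := by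
  obtain ⟨a, haP, ha, hfa⟩ := nonempty_inter_preimage_of_filling_pos hA
  obtain ⟨k, hk⟩ := exists_cylinder_subset_of_isOpen
    ((isOpen_cylinder _ A.value A.length).preimage hf) hfa
  let j := max k (A.depth + 1)
  have hAj : A.depth < j := Nat.lt_of_succ_le (le_max_right _ _)
  have hmaps : MapsTo f (cylinder a j) (cylinder A.value A.length) :=
    (cylinder_anti a (le_max_left _ _)).trans hk
  let C := closure (f '' (P ∩ cylinder a j))
  have hCA : C ⊆ cylinder A.value A.length :=
    closure_minimal (image_subset_iff.2 fun b hb => hmaps hb.2) (isClosed_cylinder _ _)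
  have hμC : μ C ≠ 0 := hP _ (isOpen_cylinder _ a j) ⟨a, haP, self_mem_cylinder a j⟩
  obtain ⟨z, hz, m, hm, hrm⟩ := exists_lt_cond_cylinder_of_isClosed isClosed_closure hμC
    (ENNReal.ofReal_lt_one.2 hr) (A.length + 1)
  refine ⟨⟨a, j, z, m⟩, ⟨⟨hAj.le, ha, (Nat.le_succ _).trans hm, hCA hz⟩, hAj, hm, hmaps⟩, ?_⟩
  rw [← ofReal_measureReal] at hrm
  exact (ENNReal.ofReal_lt_ofReal_iff'.1 hrm).1

/-- The invariant of the construction of three points without common ones beyond `n₀`, at a time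
when the point with index `i : Fin 3` is to move; indices are added modulo `3`. -/
structure IsReady (μ : Measure (ℕ → Bool)) (f : (ℕ → ℕ) → ℕ → Bool) (P : Set (ℕ → ℕ)) (n₀ : ℕ)
    (i : Fin 3) (T : Fin 3 → GraphBox) : Prop where
  length_eq : ∀ j, (T j).length = (T i).length
  no_common_one : ∀ l, n₀ ≤ l → l < (T i).length → ∃ j, (T j).value l = false
  filling_pos : 0 < (T i).filling μ f P
  one_lt_filling_add_filling : 1 < (T (i + 1)).filling μ f P + (T (i + 2)).filling μ f P

theorem exists_isReady [IsFiniteMeasure μ] (hP : HasNonnullHulls μ f P) (hne : P.Nonempty) :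
    ∃ n₀ T, IsReady μ f P n₀ 0 T := by
  obtain ⟨a, ha⟩ := hne
  have hμ : μ (closure (f '' (P ∩ cylinder a 0))) ≠ 0 :=
    hP _ (isOpen_cylinder _ a 0) ⟨a, ha, self_mem_cylinder a 0⟩
  obtain ⟨z, -, n, -, hn⟩ := exists_lt_cond_cylinder_of_isClosed isClosed_closure hμ
    (ENNReal.ofReal_lt_one.2 (by norm_num : (1 / 2 : ℝ) < 1)) 0
  rw [← ofReal_measureReal] at hn
  have hfill : 1 / 2 < filling μ f P ⟨a, 0, z, n⟩ := (ENNReal.ofReal_lt_ofReal_iff'.1 hn).1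
  exact ⟨n, fun _ => ⟨a, 0, z, n⟩, fun _ => rfl, fun l hl hl' => absurd hl' hl.not_gt,
    by linarith, by linarith⟩

variable {p : ℕ → unitInterval} {T : Fin 3 → GraphBox} {n₀ : ℕ} {i : Fin 3}

theorem IsReady.exists_moves (hp : ∀ n, (p n : ℝ) ≤ 1 / 2) (hf : Continuous f)
    (hP : HasNonnullHulls (cantorMeasure p) f P) (hT : IsReady (cantorMeasure p) f P n₀ i T) :
    ∃ A B D, Decides f (T i) A ∧ T (i + 1) ≤ B ∧ T (i + 2) ≤ D ∧
      B.length = A.length ∧ D.length = A.length ∧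
      (∀ l, (T i).length ≤ l → l < A.length → B.value l = false ∨ D.value l = false) ∧
      0 < B.filling (cantorMeasure p) f P ∧
      1 < D.filling (cantorMeasure p) f P + A.filling (cantorMeasure p) f P := by
  have hsum := hT.one_lt_filling_add_filling
  -- The idle hulls keep the sum of their proportions, so each keeps at least that sum minus `1`.
  obtain ⟨A, hA, hfill⟩ := exists_decides_lt_filling hf hP hT.filling_pos
    (r := 2 - ((T (i + 1)).filling _ f P + (T (i + 2)).filling _ f P)) (by linarith)
  obtain ⟨x, hx, y, hy, hxy, hle⟩ := exists_disjoint_extension_le_cond_add_cond hp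
    ((T (i + 1)).hull f P) ((T (i + 2)).hull f P) (T (i + 1)).value (T (i + 2)).value
    hA.length_lt.le
  let B : GraphBox := ⟨(T (i + 1)).arg, (T (i + 1)).depth, x, A.length⟩
  let D : GraphBox := ⟨(T (i + 2)).arg, (T (i + 2)).depth, y, A.length⟩
  have hB : T (i + 1) ≤ B := ⟨le_rfl, self_mem_cylinder _ _,
    (hT.length_eq _).trans_le hA.length_lt.le, hT.length_eq (i + 1) ▸ hx⟩
  have hD : T (i + 2) ≤ D := ⟨le_rfl, self_mem_cylinder _ _,
    (hT.length_eq _).trans_le hA.length_lt.le, hT.length_eq (i + 2) ▸ hy⟩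
  have hBD : (T (i + 1)).filling (cantorMeasure p) f P + (T (i + 2)).filling (cantorMeasure p) f P ≤
      B.filling (cantorMeasure p) f P + D.filling (cantorMeasure p) f P := by
    rw [filling, filling, hT.length_eq (i + 1), hT.length_eq (i + 2)]
    exact hle
  have hB₁ := filling_le_one (A := B) (f := f) (μ := cantorMeasure p) (P := P)
  have hD₁ := filling_le_one (A := D) (f := f) (μ := cantorMeasure p) (P := P)
  exact ⟨A, B, D, hA, hB, hD, rfl, rfl, hxy, by linarith, by linarith⟩

theorem IsReady.exists_turn (hp : ∀ n, (p n : ℝ) ≤ 1 / 2) (hf : Continuous f)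
    (hP : HasNonnullHulls (cantorMeasure p) f P) (hT : IsReady (cantorMeasure p) f P n₀ i T) :
    ∃ T', IsReady (cantorMeasure p) f P n₀ (i + 1) T' ∧ T ≤ T' ∧ Decides f (T i) (T' i) := by
  obtain ⟨A, B, D, hA, hB, hD, hBA, hDA, hdisj, hfillB, hfillDA⟩ := hT.exists_moves hp hf hP
  obtain ⟨T', rfl, rfl, rfl⟩ : ∃ T' : Fin 3 → GraphBox, T' i = A ∧ T' (i + 1) = B ∧
      T' (i + 2) = D := ⟨fun j => ![A, B, D] (j - i), by simp⟩
  have hle : T ≤ T' := (forall_fin_three_iff_add i).2 ⟨hA.le, hB, hD⟩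
  have h2 : i + 1 + 1 = i + 2 := by rw [add_assoc]; rfl
  have h3 : i + 1 + 2 = i := by rw [add_assoc]; exact add_zero i
  refine ⟨T', ⟨?_, fun l hl hl' => ?_, hfillB, by rwa [h2, h3]⟩, hle, hA⟩
  · exact (forall_fin_three_iff_add i).2 ⟨hBA.symm, rfl, hDA.trans hBA.symm⟩
  · rcases lt_or_ge l (T i).length with hlT | hlT
    · obtain ⟨j, hj⟩ := hT.no_common_one l hl hlT
      exact ⟨j, ((hle j).value_mem l ((hT.length_eq j).symm ▸ hlT)).trans hj⟩
    · exact (hdisj l hlT (hBA ▸ hl')).elim (fun h => ⟨_, h⟩) fun h => ⟨_, h⟩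

theorem IsReady.exists_round (hp : ∀ n, (p n : ℝ) ≤ 1 / 2) (hf : Continuous f)
    (hP : HasNonnullHulls (cantorMeasure p) f P) (hT : IsReady (cantorMeasure p) f P n₀ 0 T) :
    ∃ T', IsReady (cantorMeasure p) f P n₀ 0 T' ∧ ∀ j, Decides f (T j) (T' j) := by
  obtain ⟨T₁, hT₁, hle₁, hdec₁⟩ := hT.exists_turn hp hf hP
  obtain ⟨T₂, hT₂, hle₂, hdec₂⟩ := hT₁.exists_turn hp hf hP
  obtain ⟨T₃, hT₃, hle₃, hdec₃⟩ := hT₂.exists_turn hp hf hP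
  refine ⟨T₃, hT₃, fun j => ?_⟩
  fin_cases j
  · exact hdec₁.trans_le ((hle₂.trans hle₃) _)
  · exact (hdec₂.of_le (hle₁ _)).trans_le (hle₃ _)
  · exact hdec₃.of_le ((hle₁.trans hle₂) _)

theorem exists_range_common_ones_finite (hp : ∀ n, (p n : ℝ) ≤ 1 / 2) (hf : Continuous f)
    (hP : HasNonnullHulls (cantorMeasure p) f P) (hne : P.Nonempty) :
    ∃ x : Fin 3 → ℕ → Bool, (∀ j, x j ∈ range f) ∧ {l | ∀ j, x j l = true}.Finite := by
  obtain ⟨n₀, T₀, hT₀⟩ := exists_isReady hP hne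
  choose! next hready hdecides using
    fun T (hT : IsReady (cantorMeasure p) f P n₀ 0 T) => hT.exists_round hp hf hP
  let T : ℕ → Fin 3 → GraphBox := fun k => next^[k] T₀
  have hTsucc : ∀ k, T (k + 1) = next (T k) := fun k => iterate_succ_apply' next k T₀
  have hT : ∀ k, IsReady (cantorMeasure p) f P n₀ 0 (T k) := fun k => by
    induction k with
    | zero => exact hT₀
    | succ k ih => exact hTsucc k ▸ hready _ ih
  have hdec : ∀ j k, Decides f (T k j) (T (k + 1) j) := fun j k =>
    hTsucc k ▸ hdecides _ (hT k) j
  choose x hx hxT using fun j => exists_mem_range_of_decides (hdec j)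
  refine ⟨x, hx, (finite_Iio n₀).subset fun l hl => ?_⟩
  by_contra! hl₀
  have hlength : StrictMono fun k => (T k 0).length :=
    strictMono_nat_of_lt_succ fun k => (hdec 0 k).length_lt
  have hlk : l < (T (l + 1) 0).length := l.lt_succ_self.trans_le (hlength.le_apply (x := l + 1))
  obtain ⟨j, hj⟩ := (hT (l + 1)).no_common_one l (not_lt.1 hl₀) hlk
  have hxl : x j l = (T (l + 1) j).value l :=
    hxT j (l + 1) l (((hT (l + 1)).length_eq j).symm ▸ hlk)
  exact Bool.false_ne_true (hj.symm.trans (hxl.symm.trans (hl j)))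

end GraphBox

theorem infinite_of_mem_of_forall_ne_principal {α : Type*} {F : Filter α}
    (hF : ∀ t, F ≠ Filter.principal t) {s : Set α} (hs : s ∈ F) : s.Infinite := by
  intro hfin
  have hsubsets : {t | t ∈ F ∧ t ⊆ s}.Finite := hfin.finite_subsets.subset fun t ht => ht.2
  refine hF (⋂₀ {t | t ∈ F ∧ t ⊆ s}) (le_antisymm ?_ fun u hu => ?_)
  · exact Filter.le_principal_iff.2 ((Filter.sInter_mem hsubsets).2 fun t ht => ht.1)
  · exact fun y hy => (hy (u ∩ s) ⟨Filter.inter_mem hu hs, inter_subset_right⟩).1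

theorem mainTheorem9_general {p : ℕ → unitInterval} (hp : ∀ n, (p n : ℝ) ≤ 1 / 2)
    {S : Set (ℕ → Bool)} (hS : AnalyticSet S)
    (hcommon : ∀ x : Fin 3 → ℕ → Bool, (∀ j, x j ∈ S) → {n | ∀ j, x j n = true}.Infinite) :
    ∃ K, IsFSigma K ∧ cantorMeasure p K = 0 ∧ S ⊆ K := by
  rw [AnalyticSet] at hS
  rcases hS with rfl | ⟨f, hf, rfl⟩
  · exact ⟨∅, isFSigma_of_isClosed isClosed_empty, measure_empty, Subset.rfl⟩
  refine (coveredByNullFSigma_range_or_exists_hasNonnullHulls (cantorMeasure p) f).resolve_right ?_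
  rintro ⟨P, hne, hP⟩
  obtain ⟨x, hx, hfin⟩ := GraphBox.exists_range_common_ones_finite hp hf hP hne
  exact hcommon x hx hfin

theorem infinite_common_ones_of_mem_filterSet {F : Filter ℕ} (hF : ∀ s, F ≠ Filter.principal s)
    {ι : Type*} [Finite ι] {x : ι → ℕ → Bool} (hx : ∀ j, x j ∈ filterSet F) :
    {n | ∀ j, x j n = true}.Infinite := by
  refine infinite_of_mem_of_forall_ne_principal hF ?_
  rw [ofPred_forall]
  exact Filter.iInter_mem.2 hx

theorem analyticSet_of_measurableSet_borel {X : Type*} [TopologicalSpace X] [PolishSpace X]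
    {s : Set X} (hs : MeasurableSet[borel X] s) : AnalyticSet s := by
  borelize X
  exact hs.analyticSet

theorem mainTheorem9 (p : ℕ → unitInterval)
    (hp : ∀ n, 0 < (p n : ℝ) ∧ (p n : ℝ) ≤ 1 / 2)
    (F : Filter ℕ) (hproper : F.NeBot) (hnonprincipal : ∀ s : Set ℕ, F ≠ Filter.principal s)
    (hF : MeasurableSet[borel (ℕ → Bool)] (filterSet F) ∨ AnalyticSet (filterSet F)) :
    ∃ K : Set (ℕ → Bool), IsFSigma K ∧ cantorMeasure p K = 0 ∧ filterSet F ⊆ K := by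
  have : PolishSpace Bool := inferInstance
  have hanalytic : AnalyticSet (filterSet F) := hF.elim analyticSet_of_measurableSet_borel id
  exact mainTheorem9_general (fun n => (hp n).2) hanalytic fun _ hx =>
    infinite_common_ones_of_mem_filterSet hnonprincipal hx
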